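/- **Setting.** Let $n\ge 2$, $0<\rho_-<\rho_+$, $g>0$, $T>0$, and let $\Omega\subset\mathbb R^n$ be open (for instance a bounded domain; a periodic channel $\mathbb T^{n-1}\times(-L,L)$ is treated by lifting, i.e. $\Omega=\mathbb R^{n-1}\times(-L,L)$ and all functions $1$-periodic in $y_1,\dots,y_{n-1}$). Set $$\mathscr D=\{(y,t)\in\mathbb R^n\times(0,T):\ y-\tfrac12 gt^2e_n\in\Omega\}.$$ The spaces $L^1(\mathscr D),L^3(\mathscr D)$ and weak convergence in $L^1(\mathscr D)$ are understood on bounded portions of $\mathscr D$; for bounded $\Omega$ these are the usual notions, and in the periodic case they are the usual notions on one period cell. A measure on $\mathscr D$ is a signed Radon measure (finite on compact subsets), it is called negative if $\nu[\varphi]\le0$ for all $0\le\varphi\in C_c^\infty(\mathscr D)$, and weak convergence $\nu_k\rightharpoonup\bar\nu$ means $\nu_k[\varphi]\to\bar\nu[\varphi]$ for all $\varphi\in C^\infty_c(\mathscr D)$. Let $Z=\mathbb R\times\mathbb R^n\times\mathbb R^n\times\mathbb R^n\times\mathcal S_0^{n\times n}\times\mathbb R\ni z=(\mu,w,m,h,\sigma,e)$,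 where $\mathcal S^{n\times n}_0$ are the symmetric trace-free matrices. For $z\in Z$ with $\rho_-<\mu<\rho_+$ let $$\tilde M(z)=\frac{\mu\rho_-\rho_+\,w\otimes w-\rho_-\rho_+(m\otimes w+w\otimes m)+(\rho_++\rho_--\mu)\,m\otimes m}{(\rho_+-\mu)(\mu-\rho_-)}-\sigma,\qquad T_\pm(z)=\frac{\rho_\pm}{2}\frac{|m-\rho_\mp w|^2}{(\mu-\rho_\mp)^2};$$ $T_\pm(z)$ is defined by the same formula whenever $\mu\neq\rho_\mp$, and $T_\pm(z):=0$ if $\mu=\rho_\mp$. Let $$U=\{z\in Z:\ \rho_-<\mu<\rho_+,\ \lambda_{\max}(\tilde M(z))<\tfrac2n e\}.$$ **Hypotheses.** For $k\in\mathbb N$ let $\mu_k\in L^\infty(\mathscr D)$ with $\mu_k\in\{\rho_-,\rho_+\}$ a.e., $w_k\in L^3(\mathscr D;\mathbb R^n)$, $q_k\in L^1(\mathscr D)$ with $(\tfrac12\mu_k|w_k|^2+q_k)w_k\in L^1(\mathscr D;\mathbb R^n)$, and let $\nu_k$ be negative measures on $\mathscr D$ such that in the sense of distributions on $\mathscr D$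 $$\partial_t(\mu_kw_k)+\operatorname{div}(\mu_kw_k\otimes w_k)+\nabla q_k=0,\quad \operatorname{div}w_k=0,\quad \partial_t\mu_k+\operatorname{div}(\mu_kw_k)=0,$$ $$\partial_t\big(\tfrac12\mu_k|w_k|^2\big)+\operatorname{div}\big((\tfrac12\mu_k|w_k|^2+q_k)w_k\big)=\nu_k\le 0 .$$ Let $z_k=(\mu_k,w_k,m_k,h_k,\sigma_k,e_k)$ with $e_k=\frac12\mu_k|w_k|^2$, $m_k=\mu_kw_k$, $h_k=(e_k+q_k)w_k$, $\sigma_k=\mu_kw_k\otimes w_k-\frac2ne_k\,\mathrm{Id}$. Suppose that $z_k\rightharpoonup\bar z$ and $q_k\rightharpoonup\bar q$ weakly in $L^1(\mathscr D)$, where $\bar z$, $\bar q$ are integrable, and that $\nu_k\rightharpoonup\bar\nu$ for some measure $\bar\nu$ on $\mathscr D$. **Conclusions.** 1. $\bar z=(\bar\mu,\bar w,\bar m,\bar h,\bar\sigma,\bar e)$ solves, in the sense of distributions on $\mathscr D$ and with $\bar\nu$ negative, $$\partial_t\bar m+\operatorname{div}\bar\sigma+\nabla(\tfrac2n\bar e+\bar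 q)=0,\quad\operatorname{div}\bar w=0,\quad\partial_t\bar\mu+\operatorname{div}\bar m=0,\quad\partial_t\bar e+\operatorname{div}\bar h=\bar\nu .$$ 2. $\bar z(y,t)\in\overline U$ for almost every $(y,t)\in\mathscr D$. 3. If $\sup_k\|w_k\|_{L^\infty(\mathscr D)}<\infty$, then $T_+(\bar z),T_-(\bar z)\in L^\infty(\mathscr D)$ and $$\|T_\pm(\bar z)\|_{L^\infty(\mathscr D)}\le\frac{\rho_+}{2}\sup_k\|w_k\|_{L^\infty(\mathscr D)}^2 .$$ 4. Initial data and the no-penetration condition are inherited. Write $\mathscr D(t)=\Omega+\frac12gt^2e_n$, $\mathscr D^*=\mathscr D\cup(\Omega\times\{0\})$ and $\overline{\mathscr D}^*=\bigcup_{t\in[0,T)}\overline{\mathscr D(t)}\times\{t\}$. Let $\rho_0\in\{\rho_-,\rho_+\}$ a.e. on $\Omega$ and $v_0\in L^\infty(\Omega;\mathbb R^n)$ with $\int_\Omega v_0\cdot\nabla\psi\,dx=0$ for all $\psi\in C_c^\infty(\mathbb R^n)$. Suppose that in addition, with negative measures $\nu^*_k$ on $\mathscr D^*$ converging weakly (against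 $C_c^\infty(\mathscr D^*)$) to a measure $\bar\nu^*$ on $\mathscr D^*$, the functions $(\mu_k,w_k,q_k)$ satisfy $$\int_{\mathscr D}\mu_kw_k\cdot\partial_t\Phi+(\mu_kw_k\otimes w_k+q_k\mathrm{Id}):\nabla\Phi+\int_\Omega\rho_0v_0\cdot\Phi(\cdot,0)=0,\qquad \int_{\mathscr D}(w_k-gte_n)\cdot\nabla\Psi=0,$$ $$\int_{\mathscr D}\mu_k\partial_t\Psi+\mu_kw_k\cdot\nabla\Psi+\int_\Omega\rho_0\Psi(\cdot,0)=0,\qquad \int_{\mathscr D}e_k\partial_t\varphi+h_k\cdot\nabla\varphi+\int_\Omega\tfrac12\rho_0|v_0|^2\varphi(\cdot,0)=-\nu_k^*[\varphi]$$ for all $\Phi\in C_c^\infty(\mathscr D^*;\mathbb R^n)$, $\varphi\in C_c^\infty(\mathscr D^*)$, $\Psi\in C_c^\infty(\overline{\mathscr D}^*)$. Then $\bar\nu^*$ is negative and the same identities hold for $(\bar z,\bar q,\bar\nu^*)$, i.e. with $\mu_k,w_k,\mu_kw_k,\ \mu_kw_k\otimes w_k+q_k\mathrm{Id},\ e_k,h_k,\nu_k^*$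 replaced by $\bar\mu,\bar w,\bar m,\ \bar\sigma+(\frac2n\bar e+\bar q)\mathrm{Id},\ \bar e,\bar h,\bar\nu^*$. -/

import Mathlib

open MeasureTheory Filter Topology Set
open scoped ENNReal ContDiff

noncomputable section

namespace RayleighTaylor

/-- Euclidean space `ℝⁿ`. -/
abbrev E (n : ℕ) := EuclideanSpace ℝ (Fin n)

/-- The last unit vector `e_n` of `ℝⁿ`. -/
def lastUnit (n : ℕ) : E n := WithLp.toLp 2 fun i => if i.val + 1 = n then 1 else 0

/-! ### Space-time domains -/

/-- The accelerated domain `𝒟 = {(y,t) : 0 < t < T, y - ½ g t² e_n ∈ Ω}`. -/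
def accDomain {n : ℕ} (Ω : Set (E n)) (g T : ℝ) : Set (E n × ℝ) :=
  {p | 0 < p.2 ∧ p.2 < T ∧ p.1 - (1 / 2 * g * p.2 ^ 2) • lastUnit n ∈ Ω}

/-- `𝒟` together with its initial time slice `Ω × {0}`. -/
def accDomainInit {n : ℕ} (Ω : Set (E n)) (g T : ℝ) : Set (E n × ℝ) :=
  {p | 0 ≤ p.2 ∧ p.2 < T ∧ p.1 - (1 / 2 * g * p.2 ^ 2) • lastUnit n ∈ Ω}

/-- The union over `t ∈ [0,T)` of `closure 𝒟(t) × {t}`, where `𝒟(t) = Ω + ½ g t² e_n`. -/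
def accDomainClosed {n : ℕ} (Ω : Set (E n)) (g T : ℝ) : Set (E n × ℝ) :=
  {p | 0 ≤ p.2 ∧ p.2 < T ∧ p.1 - (1 / 2 * g * p.2 ^ 2) • lastUnit n ∈ closure Ω}

/-! ### Test functions and their derivatives -/

/-- Smooth test functions `C_c^∞(G)`, where `D ⊆ G ⊆ closure D`: smooth functions on the whole
space-time whose restriction to `D` has support with compact closure contained in `G`.
For `G = D` open, their restrictions to `D` are precisely the functions of class `C_c^∞(D)`. -/
structure IsTest {n : ℕ} (D G : Set (E n × ℝ)) (φ : E n × ℝ → ℝ) : Prop where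
  smooth : ContDiff ℝ ∞ φ
  isCompact : IsCompact (closure (D ∩ Function.support φ))
  subset : closure (D ∩ Function.support φ) ⊆ G

/-- Time derivative `∂_t φ`. -/
def dt {n : ℕ} (φ : E n × ℝ → ℝ) (p : E n × ℝ) : ℝ := fderiv ℝ φ p (0, 1)

/-- Spatial derivative `∂_{y_j} φ`. -/
def dx {n : ℕ} (j : Fin n) (φ : E n × ℝ → ℝ) (p : E n × ℝ) : ℝ :=
  fderiv ℝ φ p (EuclideanSpace.single j 1, 0)

/-- `a · ∇φ`, with the spatial gradient. -/
def dotGrad {n : ℕ} (a : E n) (φ : E n × ℝ → ℝ) (p : E n × ℝ) : ℝ := ∑ j, a j * dx j φ p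

/-! ### Signed Radon measures -/

/-- A signed Radon measure on `G` (difference of two measures finite on compact subsets of `G`;
it need not have finite total variation). -/
structure RadonOn {n : ℕ} (G : Set (E n × ℝ)) where
  pos : Measure (E n × ℝ)
  neg : Measure (E n × ℝ)
  pos_lt_top : ∀ K ⊆ G, IsCompact K → pos K < ⊤
  neg_lt_top : ∀ K ⊆ G, IsCompact K → neg K < ⊤

/-- The pairing `ν[φ] = ∫_G φ dν`. -/
def RadonOn.pair {n : ℕ} {G : Set (E n × ℝ)} (ν : RadonOn G) (φ : E n × ℝ → ℝ) : ℝ :=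
  (∫ p in G, φ p ∂ν.pos) - ∫ p in G, φ p ∂ν.neg

/-- `ν` is negative: `ν[φ] ≤ 0` for all nonnegative `φ ∈ C_c^∞(G)`. -/
def RadonOn.IsNegative {n : ℕ} {G : Set (E n × ℝ)} (D : Set (E n × ℝ)) (ν : RadonOn G) : Prop :=
  ∀ φ, IsTest D G φ → (∀ p ∈ G, 0 ≤ φ p) → ν.pair φ ≤ 0

/-- Weak convergence of measures, `ν_k[φ] → ν[φ]` for all `φ ∈ C_c^∞(G)`. -/
def RadonOn.WeakTendsto {n : ℕ} {G : Set (E n × ℝ)} (D : Set (E n × ℝ))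
    (ν : ℕ → RadonOn G) (νlim : RadonOn G) : Prop :=
  ∀ φ, IsTest D G φ → Tendsto (fun k => (ν k).pair φ) atTop (𝓝 (νlim.pair φ))

/-! ### Integrability and weak convergence

The classes `L¹`, `L³` are taken on bounded portions of `D`. If `D` is bounded they are the usual
spaces on `D`. If `D` is the lift to `ℝⁿ` of a space-time set over `𝕋ⁿ⁻¹ × ℝ` and the functions are
`1`-periodic in the first `n-1` variables, they are the usual spaces over one period cell. -/

/-- `f ∈ L¹` on bounded portions of `D`. -/
def IntegrableBdd {n : ℕ} {F : Type*} [NormedAddCommGroup F] (D : Set (E n × ℝ))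
    (f : E n × ℝ → F) : Prop :=
  ∀ B, Bornology.IsBounded B → IntegrableOn f (D ∩ B)

/-- `f_k ⇀ f` weakly in `L¹` on bounded portions of `D`: the limit is tested with all bounded
measurable functions (of bounded support). -/
structure WeakL1 {n : ℕ} {F : Type*} [NormedAddCommGroup F] [NormedSpace ℝ F]
    (D : Set (E n × ℝ)) (f : ℕ → E n × ℝ → F) (flim : E n × ℝ → F) : Prop where
  integrable : ∀ k, IntegrableBdd D (f k)
  integrable_lim : IntegrableBdd D flim
  tendsto : ∀ φ : E n × ℝ → ℝ, Measurable φ → (∃ C, ∀ p, |φ p| ≤ C) →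
    Bornology.IsBounded (Function.support φ) →
    Tendsto (fun k => ∫ p in D, φ p • f k p) atTop (𝓝 (∫ p in D, φ p • flim p))

/-! ### The state space `Z` -/

/-- Symmetric trace-free `n × n` matrices. -/
def symTraceless (n : ℕ) : Submodule ℝ (Matrix (Fin n) (Fin n) ℝ) where
  carrier := {A | A.IsSymm ∧ A.trace = 0}
  add_mem' := fun ha hb => ⟨ha.1.add hb.1, by rw [Matrix.trace_add, ha.2, hb.2, add_zero]⟩
  zero_mem' := ⟨Matrix.isSymm_zero, Matrix.trace_zero _ _⟩
  smul_mem' := fun c _ ha => ⟨ha.1.smul c, by rw [Matrix.trace_smul, ha.2, smul_zero]⟩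

/-- The state space `Z = ℝ × ℝⁿ × ℝⁿ × ℝⁿ × 𝒮₀ⁿˣⁿ × ℝ` of tuples `z = (μ, w, m, h, σ, e)`. -/
@[ext] structure State (n : ℕ) where
  μ : ℝ
  w : E n
  m : E n
  h : E n
  σ : symTraceless n
  e : ℝ

/-- A state as an element of the product space. -/
def State.toProd {n : ℕ} (z : State n) : ℝ × E n × E n × E n × symTraceless n × ℝ :=
  (z.μ, z.w, z.m, z.h, z.σ, z.e)

/-- The product topology on `Z`. -/
instance (n : ℕ) : TopologicalSpace (State n) := TopologicalSpace.induced State.toProd inferInstance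

/-- The matrix `a ⊗ b`. -/
def outer {n : ℕ} (a b : E n) : Matrix (Fin n) (Fin n) ℝ := Matrix.of fun i j => a i * b j

theorem stress_mem {n : ℕ} (μ : ℝ) (w : E n) :
    μ • outer w w - (2 / (n : ℝ) * (1 / 2 * μ * ‖w‖ ^ 2)) • (1 : Matrix (Fin n) (Fin n) ℝ)
      ∈ symTraceless n := by
  refine ⟨?_, ?_⟩
  · ext i j
    simp [outer, Matrix.one_apply, mul_comm (w i), eq_comm]
  · rcases Nat.eq_zero_or_pos n with rfl | hn
    · simp [Matrix.trace]
    · have hn' : (n : ℝ) ≠ 0 := by positivity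
      have h1 : (outer w w).trace = ‖w‖ ^ 2 := by
        rw [EuclideanSpace.norm_sq_eq]
        simp [outer, Matrix.trace, sq]
      rw [Matrix.trace_sub, Matrix.trace_smul, Matrix.trace_smul, h1, Matrix.trace_one,
        Fintype.card_fin]
      simp only [smul_eq_mul]
      field_simp
      ring

/-- The tuple `z` associated with density `μ`, velocity `w` and pressure `q`, determined by
`m = μ w`, `h = (e + q) w`, `μ w ⊗ w = σ + (2/n) e Id` with `σ` trace-free, so `e = ½ μ |w|²`. -/
def assocState {n : ℕ} (μ : ℝ) (w : E n) (q : ℝ) : State n where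
  μ := μ
  w := w
  m := μ • w
  h := (1 / 2 * μ * ‖w‖ ^ 2 + q) • w
  σ := ⟨_, stress_mem μ w⟩
  e := 1 / 2 * μ * ‖w‖ ^ 2

/-- Weak convergence in `L¹` of all components of `z_k`. -/
structure StateWeakL1 {n : ℕ} (D : Set (E n × ℝ)) (z : ℕ → E n × ℝ → State n)
    (zlim : E n × ℝ → State n) : Prop where
  μ : WeakL1 D (fun k p => (z k p).μ) fun p => (zlim p).μ
  w : WeakL1 D (fun k p => (z k p).w) fun p => (zlim p).w
  m : WeakL1 D (fun k p => (z k p).m) fun p => (zlim p).m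
  h : WeakL1 D (fun k p => (z k p).h) fun p => (zlim p).h
  σ : ∀ i j, WeakL1 D (fun k p => (z k p).σ.1 i j) fun p => (zlim p).σ.1 i j
  e : WeakL1 D (fun k p => (z k p).e) fun p => (zlim p).e

/-! ### The relaxed set -/

/-- Largest eigenvalue of a real symmetric matrix. -/
def lambdaMax {n : ℕ} (A : Matrix (Fin n) (Fin n) ℝ) : ℝ := sSup (spectrum ℝ A)

/-- The matrix `M̃(z)`, for `ρ₋ < μ < ρ₊`. -/
def Mtilde {n : ℕ} (ρm ρp : ℝ) (z : State n) : Matrix (Fin n) (Fin n) ℝ :=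
  ((ρp - z.μ) * (z.μ - ρm))⁻¹ •
    ((z.μ * ρm * ρp) • outer z.w z.w - (ρm * ρp) • (outer z.m z.w + outer z.w z.m)
      + (ρp + ρm - z.μ) • outer z.m z.m) - z.σ.1

/-- The set of `z ∈ Z` with `ρ₋ < μ < ρ₊` and `λ_max(M̃(z)) < (2/n) e`. -/
def hullInterior (n : ℕ) (ρm ρp : ℝ) : Set (State n) :=
  {z | ρm < z.μ ∧ z.μ < ρp ∧ lambdaMax (Mtilde ρm ρp z) < 2 / (n : ℝ) * z.e}

/-- `T₊(z) = (ρ₊/2) |m - ρ₋ w|² / (μ - ρ₋)²`. -/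
def Tplus {n : ℕ} (ρm ρp : ℝ) (z : State n) : ℝ :=
  ρp / 2 * (‖z.m - ρm • z.w‖ ^ 2 / (z.μ - ρm) ^ 2)

/-- `T₋(z) = (ρ₋/2) |m - ρ₊ w|² / (μ - ρ₊)²`. -/
def Tminus {n : ℕ} (ρm ρp : ℝ) (z : State n) : ℝ :=
  ρm / 2 * (‖z.m - ρp • z.w‖ ^ 2 / (z.μ - ρp) ^ 2)

/-! ### Solutions in the sense of distributions on `D` -/

/-- Distributional solutions on `D` of
`∂_t(μw) + div(μ w⊗w) + ∇q = 0`, `div w = 0`, `∂_t μ + div(μw) = 0` and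
`∂_t(½μ|w|²) + div((½μ|w|²+q)w) = ν ≤ 0`. -/
structure IsEulerSolution {n : ℕ} (D : Set (E n × ℝ)) (μ : E n × ℝ → ℝ) (w : E n × ℝ → E n)
    (q : E n × ℝ → ℝ) (ν : RadonOn D) : Prop where
  memLp_density : MemLp μ ⊤ (volume.restrict D)
  memLp_velocity : ∀ B, Bornology.IsBounded B → MemLp w 3 (volume.restrict (D ∩ B))
  integrable_pressure : IntegrableBdd D q
  integrable_flux : IntegrableBdd D fun p => (1 / 2 * μ p * ‖w p‖ ^ 2 + q p) • w p
  momentum : ∀ (i : Fin n) (φ), IsTest D D φ →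
    ∫ p in D, (μ p * w p i * dt φ p + ∑ j, μ p * w p i * w p j * dx j φ p + q p * dx i φ p) = 0
  incompressible : ∀ φ, IsTest D D φ → ∫ p in D, dotGrad (w p) φ p = 0
  mass : ∀ φ, IsTest D D φ → ∫ p in D, (μ p * dt φ p + μ p * dotGrad (w p) φ p) = 0
  energy : ∀ φ, IsTest D D φ →
    ∫ p in D, (1 / 2 * μ p * ‖w p‖ ^ 2 * dt φ p
      + (1 / 2 * μ p * ‖w p‖ ^ 2 + q p) * dotGrad (w p) φ p) = -ν.pair φ
  negative : ν.IsNegative D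

/-- Distributional solutions on `D` of the linear system
`∂_t m + div σ + ∇((2/n)e + q) = 0`, `div w = 0`, `∂_t μ + div m = 0`, `∂_t e + div h = ν`
with a negative measure `ν`. -/
structure IsLinearSolution {n : ℕ} (D : Set (E n × ℝ)) (z : E n × ℝ → State n)
    (q : E n × ℝ → ℝ) (ν : RadonOn D) : Prop where
  integrable_density : IntegrableBdd D fun p => (z p).μ
  integrable_velocity : IntegrableBdd D fun p => (z p).w
  integrable_momentum : IntegrableBdd D fun p => (z p).m
  integrable_flux : IntegrableBdd D fun p => (z p).h
  integrable_stress : ∀ i j, IntegrableBdd D fun p => (z p).σ.1 i j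
  integrable_energy : IntegrableBdd D fun p => (z p).e
  integrable_pressure : IntegrableBdd D q
  momentum : ∀ (i : Fin n) (φ), IsTest D D φ →
    ∫ p in D, ((z p).m i * dt φ p + ∑ j, (z p).σ.1 i j * dx j φ p
      + (2 / (n : ℝ) * (z p).e + q p) * dx i φ p) = 0
  incompressible : ∀ φ, IsTest D D φ → ∫ p in D, dotGrad (z p).w φ p = 0
  mass : ∀ φ, IsTest D D φ → ∫ p in D, ((z p).μ * dt φ p + dotGrad (z p).m φ p) = 0
  energy : ∀ φ, IsTest D D φ →
    ∫ p in D, ((z p).e * dt φ p + dotGrad (z p).h φ p) = -ν.pair φ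
  negative : ν.IsNegative D

/-! ### Solutions with initial data and no-penetration boundary condition

Here the incompressibility and the mass balance are tested with functions that need not vanish at
the lateral boundary nor at `t = 0`, which contains `(w - g t e_n) · n = 0` and
`(m - μ g t e_n) · n = 0` on `∂𝒟(t)`. The momentum and the energy balance are tested with functions
that need not vanish at `t = 0`. -/

/-- Initial data `ρ₀ ∈ {ρ₋,ρ₊}` a.e. and `v₀ ∈ L^∞` with `div v₀ = 0` in `Ω`, `v₀ · n = 0` on `∂Ω` in
the weak sense. -/
structure IsInitialData {n : ℕ} (Ω : Set (E n)) (ρm ρp : ℝ) (ρ₀ : E n → ℝ) (v₀ : E n → E n) :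
    Prop where
  measurable_density : AEStronglyMeasurable ρ₀ (volume.restrict Ω)
  density : ∀ᵐ x ∂(volume.restrict Ω), ρ₀ x = ρm ∨ ρ₀ x = ρp
  memLp_velocity : MemLp v₀ ⊤ (volume.restrict Ω)
  solenoidal : ∀ ψ : E n → ℝ, ContDiff ℝ ∞ ψ → HasCompactSupport ψ →
    ∫ x in Ω, fderiv ℝ ψ x (v₀ x) = 0

/-- Weak solutions of the Euler system with local energy inequality, with no-penetration boundary
condition and initial data `(ρ₀, v₀)`. -/
structure IsEulerSolutionWithData {n : ℕ} (Ω : Set (E n)) (g T ρm ρp : ℝ) (ρ₀ : E n → ℝ)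
    (v₀ : E n → E n) (μ : E n × ℝ → ℝ) (w : E n × ℝ → E n) (q : E n × ℝ → ℝ)
    (ν : RadonOn (accDomainInit Ω g T)) : Prop where
  data : IsInitialData Ω ρm ρp ρ₀ v₀
  memLp_density : MemLp μ ⊤ (volume.restrict (accDomain Ω g T))
  memLp_velocity : ∀ B, Bornology.IsBounded B → MemLp w 3 (volume.restrict (accDomain Ω g T ∩ B))
  integrable_pressure : IntegrableBdd (accDomain Ω g T) q
  integrable_flux : IntegrableBdd (accDomain Ω g T)
    fun p => (1 / 2 * μ p * ‖w p‖ ^ 2 + q p) • w p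
  momentum : ∀ (i : Fin n) (φ), IsTest (accDomain Ω g T) (accDomainInit Ω g T) φ →
    (∫ p in accDomain Ω g T,
      (μ p * w p i * dt φ p + ∑ j, μ p * w p i * w p j * dx j φ p + q p * dx i φ p))
      + ∫ x in Ω, ρ₀ x * v₀ x i * φ (x, 0) = 0
  incompressible : ∀ φ, IsTest (accDomain Ω g T) (accDomainClosed Ω g T) φ →
    ∫ p in accDomain Ω g T, dotGrad (w p - (g * p.2) • lastUnit n) φ p = 0
  mass : ∀ φ, IsTest (accDomain Ω g T) (accDomainClosed Ω g T) φ →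
    (∫ p in accDomain Ω g T, (μ p * dt φ p + μ p * dotGrad (w p) φ p))
      + ∫ x in Ω, ρ₀ x * φ (x, 0) = 0
  energy : ∀ φ, IsTest (accDomain Ω g T) (accDomainInit Ω g T) φ →
    (∫ p in accDomain Ω g T, (1 / 2 * μ p * ‖w p‖ ^ 2 * dt φ p
      + (1 / 2 * μ p * ‖w p‖ ^ 2 + q p) * dotGrad (w p) φ p))
      + ∫ x in Ω, 1 / 2 * ρ₀ x * ‖v₀ x‖ ^ 2 * φ (x, 0) = -ν.pair φ
  negative : ν.IsNegative (accDomain Ω g T)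

/-- Weak solutions of the linear system with no-penetration boundary condition and initial data
`μ = ρ₀`, `m = ρ₀ v₀`, `e = ½ ρ₀ |v₀|²`. -/
structure IsLinearSolutionWithData {n : ℕ} (Ω : Set (E n)) (g T ρm ρp : ℝ) (ρ₀ : E n → ℝ)
    (v₀ : E n → E n) (z : E n × ℝ → State n) (q : E n × ℝ → ℝ)
    (ν : RadonOn (accDomainInit Ω g T)) : Prop where
  data : IsInitialData Ω ρm ρp ρ₀ v₀
  integrable_density : IntegrableBdd (accDomain Ω g T) fun p => (z p).μ
  integrable_velocity : IntegrableBdd (accDomain Ω g T) fun p => (z p).w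
  integrable_momentum : IntegrableBdd (accDomain Ω g T) fun p => (z p).m
  integrable_flux : IntegrableBdd (accDomain Ω g T) fun p => (z p).h
  integrable_stress : ∀ i j, IntegrableBdd (accDomain Ω g T) fun p => (z p).σ.1 i j
  integrable_energy : IntegrableBdd (accDomain Ω g T) fun p => (z p).e
  integrable_pressure : IntegrableBdd (accDomain Ω g T) q
  momentum : ∀ (i : Fin n) (φ), IsTest (accDomain Ω g T) (accDomainInit Ω g T) φ →
    (∫ p in accDomain Ω g T, ((z p).m i * dt φ p + ∑ j, (z p).σ.1 i j * dx j φ p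
      + (2 / (n : ℝ) * (z p).e + q p) * dx i φ p))
      + ∫ x in Ω, ρ₀ x * v₀ x i * φ (x, 0) = 0
  incompressible : ∀ φ, IsTest (accDomain Ω g T) (accDomainClosed Ω g T) φ →
    ∫ p in accDomain Ω g T, dotGrad ((z p).w - (g * p.2) • lastUnit n) φ p = 0
  mass : ∀ φ, IsTest (accDomain Ω g T) (accDomainClosed Ω g T) φ →
    (∫ p in accDomain Ω g T, ((z p).μ * dt φ p + dotGrad (z p).m φ p))
      + ∫ x in Ω, ρ₀ x * φ (x, 0) = 0
  energy : ∀ φ, IsTest (accDomain Ω g T) (accDomainInit Ω g T) φ →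
    (∫ p in accDomain Ω g T, ((z p).e * dt φ p + dotGrad (z p).h φ p))
      + ∫ x in Ω, 1 / 2 * ρ₀ x * ‖v₀ x‖ ^ 2 * φ (x, 0) = -ν.pair φ
  negative : ν.IsNegative (accDomain Ω g T)

end RayleighTaylor

end

open RayleighTaylor

namespace RayleighTaylor

/-! ### Calculus of weak `L¹` convergence -/

section WeakConvergence

variable {n : ℕ} {D : Set (E n × ℝ)}

/-! In the variables `z` and `q` the Euler system is linear: its nonlinear fluxes are components of
`z`, up to the trace part of the stress, which joins the pressure. Each weak formulation therefore
pairs a weakly convergent sequence with derivatives of a test function, and conclusions 1 and 4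
follow by passing to the limit; the initial terms do not depend on `k`.

The pointwise conclusions rest on one principle: an affine inequality that holds a.e. along the
sequence survives weak convergence (`WeakL1.ae_nonneg`). The relaxed set is convex, and `supportFun`
writes its defining condition as a family of affine inequalities, by completing squares in two real
parameters `a`, `b`. For states coming from Euler each of them is minus a nonnegative multiple of a
square (`supportFun_assocState_nonpos`). Taking a countable dense set of parameters gives all
inequalities for the limit off a single null set. They imply membership in the closure because a
slight contraction towards an interior centre makes them strict (`contractState_mem_hullInterior`).

The bounds on `Tplus` and `Tminus` use the same principle, applied to `‖m - ρ w‖ ≤ S |μ - ρ|` with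
`ρ = ρ₋, ρ₊`: both sides come from quantities linear in `z`, since `μ - ρ` has a fixed sign
(`WeakL1.ae_norm_le`). -/

theorem isOpen_accDomain {Ω : Set (E n)} (hΩ : IsOpen Ω) (g T : ℝ) :
    IsOpen (accDomain Ω g T) := by
  have h1 : IsOpen {p : E n × ℝ | 0 < p.2} := isOpen_lt continuous_const continuous_snd
  have h2 : IsOpen {p : E n × ℝ | p.2 < T} := isOpen_lt continuous_snd continuous_const
  have h3 : IsOpen {p : E n × ℝ | p.1 - (1 / 2 * g * p.2 ^ 2) • lastUnit n ∈ Ω} :=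
    hΩ.preimage (by fun_prop)
  exact h1.inter (h2.inter h3)

/-- Ensures that the integrals in `WeakL1.tendsto` are genuine and not the default value `0`, so
that they are additive and commute with continuous linear maps. -/
theorem integrableOn_smul_of_integrableBdd {F : Type*} [NormedAddCommGroup F] [NormedSpace ℝ F]
    (hD : MeasurableSet D) {f : E n × ℝ → F} (hf : IntegrableBdd D f) {φ : E n × ℝ → ℝ}
    (hφ : Measurable φ) (hb : ∃ C, ∀ p, |φ p| ≤ C)
    (hs : Bornology.IsBounded (Function.support φ)) :
    IntegrableOn (fun p => φ p • f p) D := by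
  obtain ⟨C, hC⟩ := hb
  have h1 : IntegrableOn (fun p => φ p • f p) (D ∩ Function.support φ) :=
    Integrable.bdd_smul (hf _ hs) C hφ.aestronglyMeasurable (ae_of_all _ hC)
  refine h1.of_forall_sdiff_eq_zero hD fun p hp => ?_
  have : φ p = 0 := by
    by_contra h
    exact hp.2 ⟨hp.1, h⟩
  simp [this]

theorem ae_restrict_of_forall_ball {P : E n × ℝ → Prop}
    (h : ∀ N : ℕ, ∀ᵐ p ∂(volume.restrict (D ∩ Metric.ball 0 N)), P p) :
    ∀ᵐ p ∂(volume.restrict D), P p := by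
  have : D = ⋃ N : ℕ, D ∩ Metric.ball 0 (N : ℝ) := by
    rw [← inter_iUnion, Metric.iUnion_ball_nat, inter_univ]
  rw [this, ae_restrict_iUnion_iff]
  exact h

theorem IntegrableBdd.aestronglyMeasurable {F : Type*} [NormedAddCommGroup F]
    {f : E n × ℝ → F} (hf : IntegrableBdd D f) :
    AEStronglyMeasurable f (volume.restrict D) := by
  have : D = ⋃ N : ℕ, D ∩ Metric.ball 0 (N : ℝ) := by
    rw [← inter_iUnion, Metric.iUnion_ball_nat, inter_univ]
  rw [this, aestronglyMeasurable_iUnion_iff]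
  exact fun N => (hf _ Metric.isBounded_ball).aestronglyMeasurable

namespace WeakL1

theorem of_integrableBdd {f : E n × ℝ → ℝ} (hf : IntegrableBdd D f) :
    WeakL1 D (fun _ => f) f where
  integrable _ := hf
  integrable_lim := hf
  tendsto _ _ _ _ := tendsto_const_nhds

theorem of_continuous {f : E n × ℝ → ℝ} (hf : Continuous f) : WeakL1 D (fun _ => f) f :=
  of_integrableBdd fun _ hB => (hf.continuousOn.integrableOn_compact hB.isCompact_closure).mono_set
    (inter_subset_right.trans subset_closure)

theorem const (c : ℝ) : WeakL1 D (fun _ _ => c) fun _ => c :=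
  of_continuous continuous_const

theorem clm {F : Type*} [NormedAddCommGroup F] [NormedSpace ℝ F] [CompleteSpace F]
    (hD : MeasurableSet D) {f : ℕ → E n × ℝ → F} {flim : E n × ℝ → F} (h : WeakL1 D f flim)
    (L : F →L[ℝ] ℝ) : WeakL1 D (fun k p => L (f k p)) fun p => L (flim p) where
  integrable k B hB := L.integrable_comp (h.integrable k B hB)
  integrable_lim B hB := L.integrable_comp (h.integrable_lim B hB)
  tendsto φ hφ hb hs := by
    have key : ∀ u : E n × ℝ → F, IntegrableBdd D u →
        ∫ p in D, φ p • L (u p) = L (∫ p in D, φ p • u p) := fun u hu => by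
      rw [← L.integral_comp_comm (integrableOn_smul_of_integrableBdd hD hu hφ hb hs)]
      simp only [map_smul]
    simp only [key _ (h.integrable _), key _ h.integrable_lim]
    exact (L.continuous.tendsto _).comp (h.tendsto φ hφ hb hs)

theorem proj (hD : MeasurableSet D) {f : ℕ → E n × ℝ → E n} {flim : E n × ℝ → E n}
    (h : WeakL1 D f flim) (j : Fin n) : WeakL1 D (fun k p => f k p j) fun p => flim p j :=
  h.clm hD (EuclideanSpace.proj j : E n →L[ℝ] ℝ)

theorem add {F : Type*} [NormedAddCommGroup F] [NormedSpace ℝ F] (hD : MeasurableSet D)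
    {f f' : ℕ → E n × ℝ → F} {flim flim' : E n × ℝ → F} (h : WeakL1 D f flim)
    (h' : WeakL1 D f' flim') :
    WeakL1 D (fun k p => f k p + f' k p) fun p => flim p + flim' p where
  integrable k B hB := (h.integrable k B hB).add (h'.integrable k B hB)
  integrable_lim B hB := (h.integrable_lim B hB).add (h'.integrable_lim B hB)
  tendsto φ hφ hb hs := by
    have key : ∀ u v : E n × ℝ → F, IntegrableBdd D u → IntegrableBdd D v →
        ∫ p in D, φ p • (u p + v p) = (∫ p in D, φ p • u p) + ∫ p in D, φ p • v p :=
      fun u v hu hv => by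
        rw [← integral_add (integrableOn_smul_of_integrableBdd hD hu hφ hb hs)
          (integrableOn_smul_of_integrableBdd hD hv hφ hb hs)]
        simp only [smul_add]
    simp only [key _ _ (h.integrable _) (h'.integrable _),
      key _ _ h.integrable_lim h'.integrable_lim]
    exact (h.tendsto φ hφ hb hs).add (h'.tendsto φ hφ hb hs)

theorem const_smul {F : Type*} [NormedAddCommGroup F] [NormedSpace ℝ F] {f : ℕ → E n × ℝ → F}
    {flim : E n × ℝ → F} (h : WeakL1 D f flim) (c : ℝ) :
    WeakL1 D (fun k p => c • f k p) fun p => c • flim p where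
  integrable k B hB := (h.integrable k B hB).smul c
  integrable_lim B hB := (h.integrable_lim B hB).smul c
  tendsto φ hφ hb hs := by
    simp only [smul_comm _ c, integral_smul]
    exact (h.tendsto φ hφ hb hs).const_smul c

theorem const_mul {f : ℕ → E n × ℝ → ℝ} {flim : E n × ℝ → ℝ} (h : WeakL1 D f flim) (c : ℝ) :
    WeakL1 D (fun k p => c * f k p) fun p => c * flim p :=
  h.const_smul c

theorem sub {F : Type*} [NormedAddCommGroup F] [NormedSpace ℝ F] (hD : MeasurableSet D)
    {f f' : ℕ → E n × ℝ → F} {flim flim' : E n × ℝ → F} (h : WeakL1 D f flim)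
    (h' : WeakL1 D f' flim') :
    WeakL1 D (fun k p => f k p - f' k p) fun p => flim p - flim' p := by
  simpa only [neg_one_smul, ← sub_eq_add_neg] using h.add hD (h'.const_smul (-1))

theorem sum (hD : MeasurableSet D) {ι : Type*} (s : Finset ι) {f : ι → ℕ → E n × ℝ → ℝ}
    {flim : ι → E n × ℝ → ℝ} (h : ∀ i, WeakL1 D (f i) (flim i)) :
    WeakL1 D (fun k p => ∑ i ∈ s, f i k p) fun p => ∑ i ∈ s, flim i p := by
  classical
  induction s using Finset.induction_on with
  | empty => simpa using const (D := D) 0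
  | insert a s ha ih => simpa only [Finset.sum_insert ha] using (h a).add hD ih

/-- One-sided pointwise bounds pass to weak limits. -/
theorem ae_nonneg {f : ℕ → E n × ℝ → ℝ} {flim : E n × ℝ → ℝ}
    (h : WeakL1 D f flim) (hf : ∀ k, ∀ᵐ p ∂(volume.restrict D), 0 ≤ f k p) :
    ∀ᵐ p ∂(volume.restrict D), 0 ≤ flim p := by
  refine ae_restrict_of_forall_ball fun N => ?_
  refine ae_nonneg_of_forall_setIntegral_nonneg (h.integrable_lim _ Metric.isBounded_ball)
    fun s hs _ => ?_
  -- The indicator of `s` alone may have unbounded support; cutting with the ball makes it an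
  -- admissible weight.
  set S : Set (E n × ℝ) := s ∩ Metric.ball 0 (N : ℝ)
  have hS : MeasurableSet S := hs.inter measurableSet_ball
  have key : ∀ u : E n × ℝ → ℝ,
      ∫ p in D, S.indicator (fun _ => (1 : ℝ)) p • u p = ∫ p in D ∩ S, u p := fun u => by
    rw [← setIntegral_indicator hS]
    congr 1
    ext p
    by_cases hp : p ∈ S <;> simp [hp]
  have hlim := h.tendsto (S.indicator fun _ => 1) (measurable_const.indicator hS)
    ⟨1, fun p => by by_cases hp : p ∈ S <;> simp [hp]⟩
    ((Metric.isBounded_ball (x := (0 : E n × ℝ)) (r := N)).subset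
      (support_indicator_subset.trans inter_subset_right))
  simp only [key] at hlim
  rw [Measure.restrict_restrict hs, show s ∩ (D ∩ Metric.ball 0 (N : ℝ)) = D ∩ S from
    inter_left_comm _ _ _]
  refine ge_of_tendsto' hlim fun k => integral_nonneg_of_ae ?_
  exact ae_restrict_of_ae_restrict_of_subset inter_subset_left (hf k)

end WeakL1

/-! ### Convergence of integrals against test functions -/

/-- `ψ` coincides on `D` with a bounded measurable function of bounded support. -/
def IsWeight (D : Set (E n × ℝ)) (ψ : E n × ℝ → ℝ) : Prop :=
  ∃ φ : E n × ℝ → ℝ, Measurable φ ∧ (∃ C, ∀ p, |φ p| ≤ C) ∧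
    Bornology.IsBounded (Function.support φ) ∧ EqOn ψ φ D

/-- `φ` is controlled only on `D`: outside, its derivatives may be unbounded or have unbounded
support. Hence the derivative is truncated by the indicator of `D`. The set `G` plays no role, so
the same lemma serves the interior, initial and boundary test functions. -/
theorem IsTest.isWeight_fderiv (hD : IsOpen D) {G : Set (E n × ℝ)} {φ : E n × ℝ → ℝ}
    (hφ : IsTest D G φ) (v : E n × ℝ) : IsWeight D fun p => fderiv ℝ φ p v := by
  have hcont : Continuous fun p => fderiv ℝ φ p v :=
    (hφ.smooth.continuous_fderiv (by simp)).clm_apply continuous_const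
  have hsupp : ∀ p ∈ D, fderiv ℝ φ p v ≠ 0 → p ∈ closure (D ∩ Function.support φ) := by
    intro p hp hne
    by_contra hcl
    -- As `D` is open, `φ` vanishes on a whole neighbourhood of `p`, not merely at `p`.
    have hev : φ =ᶠ[𝓝 p] fun _ => 0 := by
      filter_upwards [hD.mem_nhds hp, isClosed_closure.isOpen_compl.mem_nhds hcl] with x hxD hx
      by_contra h0
      exact hx (subset_closure ⟨hxD, h0⟩)
    exact hne (by rw [hev.fderiv_eq]; simp)
  obtain ⟨C, hC⟩ := hφ.isCompact.exists_bound_of_continuousOn hcont.continuousOn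
  refine ⟨D.indicator fun p => fderiv ℝ φ p v, hcont.measurable.indicator hD.measurableSet,
    ⟨max C 0, fun p => ?_⟩, hφ.isCompact.isBounded.subset fun p hp => ?_,
    fun p hp => (indicator_of_mem hp (fun p => fderiv ℝ φ p v)).symm⟩
  · by_cases hp : p ∈ D
    · rw [indicator_of_mem hp]
      by_cases h0 : fderiv ℝ φ p v = 0
      · simp [h0]
      · exact (hC p (hsupp p hp h0)).trans (le_max_left _ _)
    · simp [hp]
  · by_cases hpD : p ∈ D
    · rw [Function.mem_support, indicator_of_mem hpD] at hp
      exact hsupp p hpD hp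
    · simp [hpD] at hp

theorem IsTest.isWeight_dt (hD : IsOpen D) {G : Set (E n × ℝ)} {φ : E n × ℝ → ℝ}
    (hφ : IsTest D G φ) : IsWeight D (dt φ) :=
  hφ.isWeight_fderiv hD _

theorem IsTest.isWeight_dx (hD : IsOpen D) {G : Set (E n × ℝ)} {φ : E n × ℝ → ℝ}
    (hφ : IsTest D G φ) (j : Fin n) : IsWeight D (dx j φ) :=
  hφ.isWeight_fderiv hD _

/-- The integrals of `F_k` over `D` exist and converge to the integral of `Flim`. -/
structure IntegralTendsto (D : Set (E n × ℝ)) (F : ℕ → E n × ℝ → ℝ) (Flim : E n × ℝ → ℝ) :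
    Prop where
  integrable : ∀ k, IntegrableOn (F k) D
  integrable_lim : IntegrableOn Flim D
  tendsto : Tendsto (fun k => ∫ p in D, F k p) atTop (𝓝 (∫ p in D, Flim p))

theorem WeakL1.mul_weight (hD : MeasurableSet D) {f : ℕ → E n × ℝ → ℝ} {flim : E n × ℝ → ℝ}
    (h : WeakL1 D f flim) {ψ : E n × ℝ → ℝ} (hψ : IsWeight D ψ) :
    IntegralTendsto D (fun k p => f k p * ψ p) fun p => flim p * ψ p := by
  obtain ⟨φ, hφ, hb, hs, heq⟩ := hψ
  have hE : ∀ u : E n × ℝ → ℝ, EqOn (fun p => φ p • u p) (fun p => u p * ψ p) D :=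
    fun u p hp => by simp only [heq hp, smul_eq_mul, mul_comm]
  refine ⟨fun k => ?_, ?_, ?_⟩
  · exact (integrableOn_smul_of_integrableBdd hD (h.integrable k) hφ hb hs).congr_fun (hE _) hD
  · exact (integrableOn_smul_of_integrableBdd hD h.integrable_lim hφ hb hs).congr_fun (hE _) hD
  · simpa only [setIntegral_congr_fun hD (hE _)] using h.tendsto φ hφ hb hs

namespace IntegralTendsto

theorem add {F F' : ℕ → E n × ℝ → ℝ} {Flim Flim' : E n × ℝ → ℝ} (h : IntegralTendsto D F Flim)
    (h' : IntegralTendsto D F' Flim') :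
    IntegralTendsto D (fun k p => F k p + F' k p) fun p => Flim p + Flim' p where
  integrable k := (h.integrable k).add (h'.integrable k)
  integrable_lim := h.integrable_lim.add h'.integrable_lim
  tendsto := by
    simp only [integral_add (h.integrable _) (h'.integrable _),
      integral_add h.integrable_lim h'.integrable_lim]
    exact h.tendsto.add h'.tendsto

theorem sum {ι : Type*} (s : Finset ι) {F : ι → ℕ → E n × ℝ → ℝ} {Flim : ι → E n × ℝ → ℝ}
    (h : ∀ i, IntegralTendsto D (F i) (Flim i)) :
    IntegralTendsto D (fun k p => ∑ i ∈ s, F i k p) fun p => ∑ i ∈ s, Flim i p where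
  integrable k := integrable_finsetSum s fun i _ => (h i).integrable k
  integrable_lim := integrable_finsetSum s fun i _ => (h i).integrable_lim
  tendsto := by
    simp only [integral_finsetSum s fun i _ => (h i).integrable _,
      integral_finsetSum s fun i _ => (h i).integrable_lim]
    exact tendsto_finsetSum s fun i _ => (h i).tendsto

end IntegralTendsto

theorem IntegralTendsto.dotGrad (hD : IsOpen D) {a : ℕ → E n × ℝ → E n} {alim : E n × ℝ → E n}
    (h : ∀ j, WeakL1 D (fun k p => a k p j) fun p => alim p j) {G : Set (E n × ℝ)}
    {φ : E n × ℝ → ℝ} (hφ : IsTest D G φ) :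
    IntegralTendsto D (fun k p => dotGrad (a k p) φ p) fun p => dotGrad (alim p) φ p :=
  IntegralTendsto.sum _ fun j => (h j).mul_weight hD.measurableSet (hφ.isWeight_dx hD j)

end WeakConvergence

/-! ### Passage to the limit in the equations -/

section Equations

variable {n : ℕ}

/-- Pointwise `σ + (2/n) e Id = μ w ⊗ w`, so the nonlinear momentum flux is linear in the state: the
trace removed from `σ` reappears in the pressure term. -/
theorem assocState_momentum_integrand (μ q : ℝ) (w : E n) (i : Fin n) (φ : E n × ℝ → ℝ)
    (p : E n × ℝ) :
    (assocState μ w q).m i * dt φ p + ∑ j, (assocState μ w q).σ.1 i j * dx j φ p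
        + (2 / (n : ℝ) * (assocState μ w q).e + q) * dx i φ p
      = μ * w i * dt φ p + ∑ j, μ * w i * w j * dx j φ p + q * dx i φ p := by
  have h : ∑ j, (assocState μ w q).σ.1 i j * dx j φ p
      = ∑ j, μ * w i * w j * dx j φ p
        - 2 / (n : ℝ) * (assocState μ w q).e * dx i φ p := by
    simp only [assocState, outer, Matrix.sub_apply, Matrix.smul_apply, Matrix.of_apply,
      smul_eq_mul, Matrix.one_apply, sub_mul, Finset.sum_sub_distrib, mul_ite, mul_one, mul_zero,
      ite_mul, zero_mul, Finset.sum_ite_eq, Finset.mem_univ, if_true, mul_assoc]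
  rw [h]
  simp only [assocState, PiLp.smul_apply, smul_eq_mul]
  ring

theorem dotGrad_smul (c : ℝ) (a : E n) (φ : E n × ℝ → ℝ) (p : E n × ℝ) :
    dotGrad (c • a) φ p = c * dotGrad a φ p := by
  simp only [dotGrad, PiLp.smul_apply, smul_eq_mul, mul_assoc, Finset.mul_sum]

variable {D G : Set (E n × ℝ)} {μ : ℕ → E n × ℝ → ℝ} {w : ℕ → E n × ℝ → E n}
  {q : ℕ → E n × ℝ → ℝ} {zbar : E n × ℝ → State n} {qbar : E n × ℝ → ℝ} {φ : E n × ℝ → ℝ}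

theorem tendsto_momentum_integral (hD : IsOpen D)
    (hz : StateWeakL1 D (fun k p => assocState (μ k p) (w k p) (q k p)) zbar)
    (hq : WeakL1 D q qbar) (i : Fin n) (hφ : IsTest D G φ) :
    Tendsto (fun k => ∫ p in D, (μ k p * w k p i * dt φ p
        + ∑ j, μ k p * w k p i * w k p j * dx j φ p + q k p * dx i φ p)) atTop
      (𝓝 (∫ p in D, ((zbar p).m i * dt φ p + ∑ j, (zbar p).σ.1 i j * dx j φ p
        + (2 / (n : ℝ) * (zbar p).e + qbar p) * dx i φ p))) := by
  have hm := hD.measurableSet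
  have h := (((hz.m.proj hm i).mul_weight hm (hφ.isWeight_dt hD)).add
    (IntegralTendsto.sum Finset.univ fun j =>
      (hz.σ i j).mul_weight hm (hφ.isWeight_dx hD j))).add
    (((hz.e.const_mul (2 / (n : ℝ))).add hm hq).mul_weight hm (hφ.isWeight_dx hD i))
  simpa only [assocState_momentum_integrand] using h.tendsto

theorem tendsto_mass_integral (hD : IsOpen D)
    (hz : StateWeakL1 D (fun k p => assocState (μ k p) (w k p) (q k p)) zbar)
    (hφ : IsTest D G φ) :
    Tendsto (fun k => ∫ p in D, (μ k p * dt φ p + μ k p * dotGrad (w k p) φ p)) atTop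
      (𝓝 (∫ p in D, ((zbar p).μ * dt φ p + dotGrad (zbar p).m φ p))) := by
  have hm := hD.measurableSet
  have h := (hz.μ.mul_weight hm (hφ.isWeight_dt hD)).add
    (IntegralTendsto.dotGrad hD (hz.m.proj hm) hφ)
  simpa only [assocState, dotGrad_smul] using h.tendsto

theorem tendsto_energy_integral (hD : IsOpen D)
    (hz : StateWeakL1 D (fun k p => assocState (μ k p) (w k p) (q k p)) zbar)
    (hφ : IsTest D G φ) :
    Tendsto (fun k => ∫ p in D, (1 / 2 * μ k p * ‖w k p‖ ^ 2 * dt φ p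
        + (1 / 2 * μ k p * ‖w k p‖ ^ 2 + q k p) * dotGrad (w k p) φ p)) atTop
      (𝓝 (∫ p in D, ((zbar p).e * dt φ p + dotGrad (zbar p).h φ p))) := by
  have hm := hD.measurableSet
  have h := (hz.e.mul_weight hm (hφ.isWeight_dt hD)).add
    (IntegralTendsto.dotGrad hD (hz.h.proj hm) hφ)
  simpa only [assocState, dotGrad_smul] using h.tendsto

theorem RadonOn.WeakTendsto.isNegative {ν : ℕ → RadonOn G} {νbar : RadonOn G}
    (h : RadonOn.WeakTendsto D ν νbar) (hν : ∀ k, (ν k).IsNegative D) : νbar.IsNegative D :=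
  fun φ hφ h0 => le_of_tendsto' (h φ hφ) fun k => hν k φ hφ h0

theorem isLinearSolution_of_weakL1 (hD : IsOpen D) {ν : ℕ → RadonOn D} {νbar : RadonOn D}
    (hsol : ∀ k, IsEulerSolution D (μ k) (w k) (q k) (ν k))
    (hz : StateWeakL1 D (fun k p => assocState (μ k p) (w k p) (q k p)) zbar)
    (hq : WeakL1 D q qbar) (hν : RadonOn.WeakTendsto D ν νbar) :
    IsLinearSolution D zbar qbar νbar where
  integrable_density := hz.μ.integrable_lim
  integrable_velocity := hz.w.integrable_lim
  integrable_momentum := hz.m.integrable_lim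
  integrable_flux := hz.h.integrable_lim
  integrable_stress i j := (hz.σ i j).integrable_lim
  integrable_energy := hz.e.integrable_lim
  integrable_pressure := hq.integrable_lim
  momentum i φ hφ := by
    refine tendsto_nhds_unique (tendsto_momentum_integral hD hz hq i hφ) ?_
    simp only [(hsol _).momentum i φ hφ]
    exact tendsto_const_nhds
  incompressible φ hφ := by
    refine tendsto_nhds_unique
      (IntegralTendsto.dotGrad hD (hz.w.proj hD.measurableSet) hφ).tendsto ?_
    simp only [assocState, (hsol _).incompressible φ hφ]
    exact tendsto_const_nhds
  mass φ hφ := by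
    refine tendsto_nhds_unique (tendsto_mass_integral hD hz hφ) ?_
    simp only [(hsol _).mass φ hφ]
    exact tendsto_const_nhds
  energy φ hφ := by
    refine tendsto_nhds_unique (tendsto_energy_integral hD hz hφ) ?_
    simp only [(hsol _).energy φ hφ]
    exact (hν φ hφ).neg
  negative := hν.isNegative fun k => (hsol k).negative

theorem isLinearSolutionWithData_of_weakL1 {Ω : Set (E n)} (hΩ : IsOpen Ω) {g T ρm ρp : ℝ}
    {ρ₀ : E n → ℝ} {v₀ : E n → E n} {ν : ℕ → RadonOn (accDomainInit Ω g T)}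
    {νbar : RadonOn (accDomainInit Ω g T)}
    (hsol : ∀ k, IsEulerSolutionWithData Ω g T ρm ρp ρ₀ v₀ (μ k) (w k) (q k) (ν k))
    (hz : StateWeakL1 (accDomain Ω g T)
      (fun k p => assocState (μ k p) (w k p) (q k p)) zbar)
    (hq : WeakL1 (accDomain Ω g T) q qbar)
    (hν : RadonOn.WeakTendsto (accDomain Ω g T) ν νbar) :
    IsLinearSolutionWithData Ω g T ρm ρp ρ₀ v₀ zbar qbar νbar where
  data := (hsol 0).data
  integrable_density := hz.μ.integrable_lim
  integrable_velocity := hz.w.integrable_lim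
  integrable_momentum := hz.m.integrable_lim
  integrable_flux := hz.h.integrable_lim
  integrable_stress i j := (hz.σ i j).integrable_lim
  integrable_energy := hz.e.integrable_lim
  integrable_pressure := hq.integrable_lim
  momentum i φ hφ := by
    refine tendsto_nhds_unique ((tendsto_momentum_integral (isOpen_accDomain hΩ g T) hz hq i
      hφ).add_const _) ?_
    simp only [(hsol _).momentum i φ hφ]
    exact tendsto_const_nhds
  incompressible φ hφ := by
    have hD := isOpen_accDomain hΩ g T
    -- The frame velocity `g t e_n` is continuous, hence integrable on bounded portions, and enters
    -- as a constant sequence.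
    have hw : ∀ j, WeakL1 (accDomain Ω g T)
        (fun k p => (w k p - (g * p.2) • lastUnit n) j)
        fun p => ((zbar p).w - (g * p.2) • lastUnit n) j := fun j => by
      simpa only [assocState, PiLp.sub_apply, PiLp.smul_apply, smul_eq_mul] using
        (hz.w.proj hD.measurableSet j).sub hD.measurableSet
          (WeakL1.of_continuous (f := fun p => g * p.2 * lastUnit n j) (by fun_prop))
    refine tendsto_nhds_unique (IntegralTendsto.dotGrad hD hw hφ).tendsto ?_
    simp only [(hsol _).incompressible φ hφ]
    exact tendsto_const_nhds
  mass φ hφ := by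
    refine tendsto_nhds_unique ((tendsto_mass_integral (isOpen_accDomain hΩ g T) hz
      hφ).add_const _) ?_
    simp only [(hsol _).mass φ hφ]
    exact tendsto_const_nhds
  energy φ hφ := by
    refine tendsto_nhds_unique ((tendsto_energy_integral (isOpen_accDomain hΩ g T) hz
      hφ).add_const _) ?_
    simp only [(hsol _).energy φ hφ]
    exact (hν φ hφ).neg
  negative := hν.isNegative fun k => (hsol k).negative

end Equations

/-! ### Supporting half-spaces of the relaxed set -/

section RelaxedSet

variable {n : ℕ}

/-- The quadratic form `ξ · A ξ`. -/
noncomputable def quadForm (A : Matrix (Fin n) (Fin n) ℝ) (ξ : E n) : ℝ := ∑ i, ∑ j, ξ i * ξ j * A i j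

theorem quadForm_sub (A B : Matrix (Fin n) (Fin n) ℝ) (ξ : E n) :
    quadForm (A - B) ξ = quadForm A ξ - quadForm B ξ := by
  simp only [quadForm, Matrix.sub_apply, mul_sub, Finset.sum_sub_distrib]

theorem quadForm_add (A B : Matrix (Fin n) (Fin n) ℝ) (ξ : E n) :
    quadForm (A + B) ξ = quadForm A ξ + quadForm B ξ := by
  simp only [quadForm, Matrix.add_apply, mul_add, Finset.sum_add_distrib]

theorem quadForm_smul (c : ℝ) (A : Matrix (Fin n) (Fin n) ℝ) (ξ : E n) :
    quadForm (c • A) ξ = c * quadForm A ξ := by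
  simp only [quadForm, Matrix.smul_apply, smul_eq_mul, mul_left_comm _ c, Finset.mul_sum]

theorem inner_eq_sum (a b : E n) : inner ℝ a b = ∑ i, a i * b i := by
  simp only [PiLp.inner_apply, RCLike.inner_apply, conj_trivial, mul_comm]

theorem quadForm_outer (a b ξ : E n) :
    quadForm (outer a b) ξ = inner ℝ ξ a * inner ℝ ξ b := by
  rw [inner_eq_sum, inner_eq_sum, Finset.sum_mul_sum]
  exact Finset.sum_congr rfl fun i _ => Finset.sum_congr rfl fun j _ => by
    simp only [outer, Matrix.of_apply]; ring

theorem quadForm_one (ξ : E n) : quadForm 1 ξ = ‖ξ‖ ^ 2 := by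
  simp only [quadForm, Matrix.one_apply, mul_ite, mul_one, mul_zero, Finset.sum_ite_eq,
    Finset.mem_univ, if_true, EuclideanSpace.real_norm_sq_eq]
  simp only [sq]

theorem quadForm_eq_dotProduct (A : Matrix (Fin n) (Fin n) ℝ) (v : Fin n → ℝ) :
    quadForm A (WithLp.toLp 2 v) = v ⬝ᵥ A.mulVec v := by
  simp only [quadForm, dotProduct, Matrix.mulVec, Finset.mul_sum]
  exact Finset.sum_congr rfl fun i _ => Finset.sum_congr rfl fun j _ => by ring

/-- The affine functionals whose supremum over `a` and `b` is a multiple of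
`ξ · M̃(z) ξ - (2/n) e |ξ|²` for `ρ₋ < μ < ρ₊`. -/
noncomputable def supportFun (ρm ρp : ℝ) (ξ : E n) (a b : ℝ) (z : State n) : ℝ :=
  ρp * (2 * a * (inner ℝ ξ z.m - ρm * inner ℝ ξ z.w) - a ^ 2 * (z.μ - ρm))
    + ρm * (2 * b * (inner ℝ ξ z.m - ρp * inner ℝ ξ z.w) - b ^ 2 * (ρp - z.μ))
    - (ρp - ρm) * (quadForm z.σ.1 ξ + 2 / (n : ℝ) * z.e * ‖ξ‖ ^ 2)

/-- With `x = ξ · w`, one of `m - ρ₋ w`, `m - ρ₊ w` vanishes and the functional collapses to `-ρ₋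
(ρ₊ - ρ₋) (x + b)²` if `μ = ρ₋` and to `-ρ₊ (ρ₊ - ρ₋) (x - a)²` if `μ = ρ₊`. -/
theorem supportFun_assocState_nonpos {ρm ρp : ℝ} (hρm : 0 < ρm) (hρ : ρm < ρp) {μ : ℝ}
    (hμ : μ = ρm ∨ μ = ρp) (w : E n) (q : ℝ) (ξ : E n) (a b : ℝ) :
    supportFun ρm ρp ξ a b (assocState μ w q) ≤ 0 := by
  have hs : 0 ≤ ρp - ρm := by linarith
  simp only [supportFun, assocState, quadForm_sub, quadForm_smul, quadForm_outer, quadForm_one,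
    inner_smul_right]
  generalize inner ℝ ξ w = x
  rcases hμ with rfl | rfl
  · have := mul_nonneg (mul_nonneg hρm.le hs) (sq_nonneg (x + b))
    linear_combination this
  · have := mul_nonneg (mul_nonneg (hρm.trans hρ).le hs) (sq_nonneg (x - a))
    linear_combination this

/-- The chosen `a` and `b` maximize the two concave quadratics `2aX - a²(μ - ρ₋)` and `2bY - b²(ρ₊ -
μ)`, with values `X²/(μ - ρ₋)` and `Y²/(ρ₊ - μ)`. The identity is then the partial fraction
decomposition of `M̃` in `μ`, which produces the factor `ρ₊ - ρ₋`. -/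
theorem quadForm_Mtilde {ρm ρp : ℝ} {z : State n} (h1 : ρm < z.μ) (h2 : z.μ < ρp) (ξ : E n) :
    (ρp - ρm) * (quadForm (Mtilde ρm ρp z) ξ - 2 / (n : ℝ) * z.e * ‖ξ‖ ^ 2)
      = supportFun ρm ρp ξ ((inner ℝ ξ z.m - ρm * inner ℝ ξ z.w) / (z.μ - ρm))
          ((inner ℝ ξ z.m - ρp * inner ℝ ξ z.w) / (ρp - z.μ)) z := by
  have h1' : z.μ - ρm ≠ 0 := by linarith
  have h2' : ρp - z.μ ≠ 0 := by linarith
  simp only [supportFun, Mtilde, quadForm_sub, quadForm_smul, quadForm_outer, quadForm_add]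
  generalize inner ℝ ξ z.m = x
  generalize inner ℝ ξ z.w = y
  field_simp
  ring

theorem Mtilde_isSymm (ρm ρp : ℝ) (z : State n) : (Mtilde ρm ρp z).IsSymm := by
  have hσ := z.σ.2.1
  refine Matrix.IsSymm.ext fun i j => ?_
  simp only [Mtilde, outer, Matrix.sub_apply, Matrix.add_apply, Matrix.smul_apply,
    Matrix.of_apply, smul_eq_mul, hσ.apply i j]
  ring

theorem lambdaMax_le_of_quadForm_le (hn : 0 < n) {A : Matrix (Fin n) (Fin n) ℝ} (hA : A.IsSymm)
    {c : ℝ} (h : ∀ ξ, quadForm A ξ ≤ c * ‖ξ‖ ^ 2) : lambdaMax A ≤ c := by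
  have hH : A.IsHermitian := by
    rw [Matrix.IsHermitian, Matrix.conjTranspose_eq_transpose_of_trivial]
    exact hA
  -- For `n = 0` the spectrum is empty and its `sSup` takes the default value `0`, which need not
  -- lie below `c`.
  have : Nonempty (Fin n) := ⟨⟨0, hn⟩⟩
  rw [lambdaMax, hH.spectrum_real_eq_range_eigenvalues]
  refine csSup_le (range_nonempty _) ?_
  rintro _ ⟨i, rfl⟩
  have h1 := h (hH.eigenvectorBasis i)
  have h2 := quadForm_eq_dotProduct A (hH.eigenvectorBasis i).ofLp
  rw [hH.mulVec_eigenvectorBasis, dotProduct_smul] at h2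
  have h3 : (hH.eigenvectorBasis i).ofLp ⬝ᵥ (hH.eigenvectorBasis i).ofLp = 1 := by
    have h4 := EuclideanSpace.real_norm_sq_eq (hH.eigenvectorBasis i)
    rw [hH.eigenvectorBasis.orthonormal.1 i] at h4
    simpa [dotProduct, sq] using h4.symm
  rw [h3] at h2
  have h5 : quadForm A (hH.eigenvectorBasis i) = hH.eigenvalues i := by simpa using h2
  rw [h5, hH.eigenvectorBasis.orthonormal.1 i] at h1
  simpa using h1

/-- The state contracted by the factor `1 - ε` towards the centre
`((ρ₋ + ρ₊)/2, 0, 0, 0, 0, 1)`, which lies in the relaxed set. -/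
noncomputable def contractState (ρm ρp ε : ℝ) (z : State n) : State n where
  μ := (1 - ε) * z.μ + ε * ((ρm + ρp) / 2)
  w := (1 - ε) • z.w
  m := (1 - ε) • z.m
  h := (1 - ε) • z.h
  σ := (1 - ε) • z.σ
  e := (1 - ε) * z.e + ε

/-- The functional is affine in the state; the subtracted term is `-ε` times its value at the
centre, which is negative for `ξ ≠ 0`. -/
theorem supportFun_contractState (ρm ρp ε : ℝ) (z : State n) (ξ : E n) (a b : ℝ) :
    supportFun ρm ρp ξ a b (contractState ρm ρp ε z)
      = (1 - ε) * supportFun ρm ρp ξ a b z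
        - ε * ((ρp - ρm) * ((ρp * a ^ 2 + ρm * b ^ 2) / 2 + 2 / (n : ℝ) * ‖ξ‖ ^ 2)) := by
  simp only [supportFun, contractState, inner_smul_right, Submodule.coe_smul, quadForm_smul]
  ring

theorem contractState_mem_hullInterior (hn : 0 < n) {ρm ρp : ℝ} (hρm : 0 < ρm) (hρ : ρm < ρp)
    {z : State n} (h1 : ρm ≤ z.μ) (h2 : z.μ ≤ ρp) (h : ∀ ξ a b, supportFun ρm ρp ξ a b z ≤ 0)
    {ε : ℝ} (hε : 0 < ε) (hε1 : ε ≤ 1) : contractState ρm ρp ε z ∈ hullInterior n ρm ρp := by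
  have hn' : (0 : ℝ) < n := by exact_mod_cast hn
  have hs : 0 < ρp - ρm := by linarith
  have hμ1 : ρm < (contractState ρm ρp ε z).μ := by
    simp only [contractState]
    nlinarith [mul_nonneg (sub_nonneg.2 hε1) (sub_nonneg.2 h1), mul_pos hε hs]
  have hμ2 : (contractState ρm ρp ε z).μ < ρp := by
    simp only [contractState]
    nlinarith [mul_nonneg (sub_nonneg.2 hε1) (sub_nonneg.2 h2), mul_pos hε hs]
  refine ⟨hμ1, hμ2, ?_⟩
  -- The term `(2/n) ‖ξ‖²` contributed by the centre gives the slack `ε` in the energy; the terms in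
  -- `a²` and `b²` are only discarded.
  have key : lambdaMax (Mtilde ρm ρp (contractState ρm ρp ε z))
      ≤ 2 / (n : ℝ) * ((contractState ρm ρp ε z).e - ε) := by
    refine lambdaMax_le_of_quadForm_le hn (Mtilde_isSymm _ _ _) fun ξ => ?_
    have hq := quadForm_Mtilde hμ1 hμ2 ξ
    rw [supportFun_contractState] at hq
    set a := (inner ℝ ξ (contractState ρm ρp ε z).m
      - ρm * inner ℝ ξ (contractState ρm ρp ε z).w) / ((contractState ρm ρp ε z).μ - ρm)
    set b := (inner ℝ ξ (contractState ρm ρp ε z).m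
      - ρp * inner ℝ ξ (contractState ρm ρp ε z).w) / (ρp - (contractState ρm ρp ε z).μ)
    have hle := mul_nonneg (sub_nonneg.2 hε1) (neg_nonneg.2 (h ξ a b))
    have hab : 0 ≤ ε * ((ρp - ρm) * ((ρp * a ^ 2 + ρm * b ^ 2) / 2)) := by
      have := hρm.trans hρ
      positivity
    refine le_of_mul_le_mul_left ?_ hs
    linear_combination hq + hle + hab
  refine key.trans_lt ?_
  have : 0 < 2 / (n : ℝ) := by positivity
  nlinarith [mul_pos this hε]

theorem continuous_contractState (ρm ρp : ℝ) (z : State n) :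
    Continuous fun ε => contractState ρm ρp ε z := by
  refine continuous_induced_rng.2 ?_
  change Continuous fun ε : ℝ => ((1 - ε) * z.μ + ε * ((ρm + ρp) / 2), (1 - ε) • z.w,
    (1 - ε) • z.m, (1 - ε) • z.h, (1 - ε) • z.σ, (1 - ε) * z.e + ε)
  fun_prop

/-- The endpoints `μ = ρ₋, ρ₊` are allowed: there `M̃` loses its meaning but the affine functionals
do not. The contracted states lie strictly inside and converge to `z` as `ε → 0⁺`. -/
theorem mem_closure_hullInterior (hn : 0 < n) {ρm ρp : ℝ} (hρm : 0 < ρm) (hρ : ρm < ρp)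
    {z : State n} (h1 : ρm ≤ z.μ) (h2 : z.μ ≤ ρp)
    (h : ∀ ξ a b, supportFun ρm ρp ξ a b z ≤ 0) : z ∈ closure (hullInterior n ρm ρp) := by
  have h0 : contractState ρm ρp 0 z = z := by
    ext <;> simp [contractState]
  have hlim : Tendsto (fun ε => contractState ρm ρp ε z) (𝓝[>] 0) (𝓝 z) := by
    have := ((continuous_contractState ρm ρp z).tendsto 0).mono_left
      (nhdsWithin_le_nhds (s := Ioi 0))
    rwa [h0] at this
  refine mem_closure_of_tendsto hlim ?_
  filter_upwards [Ioc_mem_nhdsGT (zero_lt_one' ℝ)] with ε hε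
  exact contractState_mem_hullInterior hn hρm hρ h1 h2 h hε.1 hε.2

theorem continuous_supportFun (ρm ρp : ℝ) (z : State n) :
    Continuous fun x : E n × ℝ × ℝ => supportFun ρm ρp x.1 x.2.1 x.2.2 z := by
  unfold supportFun quadForm
  fun_prop

end RelaxedSet

/-! ### Pointwise constraints on weak limits -/

section Constraints

variable {n : ℕ} {D : Set (E n × ℝ)}

theorem WeakL1.inner (hD : MeasurableSet D) {f : ℕ → E n × ℝ → E n} {flim : E n × ℝ → E n}
    (h : WeakL1 D f flim) (ξ : E n) :
    WeakL1 D (fun k p => inner ℝ ξ (f k p)) fun p => inner ℝ ξ (flim p) :=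
  h.clm hD (innerSL ℝ ξ)

/-- For fixed `ξ`, `a`, `b` the functional is affine in the components of the state, hence stable
under weak limits. -/
theorem StateWeakL1.supportFun (hD : MeasurableSet D) {z : ℕ → E n × ℝ → State n}
    {zbar : E n × ℝ → State n} (hz : StateWeakL1 D z zbar) (ρm ρp : ℝ) (ξ : E n) (a b : ℝ) :
    WeakL1 D (fun k p => supportFun ρm ρp ξ a b (z k p))
      fun p => supportFun ρm ρp ξ a b (zbar p) := by
  have hpart : ∀ ρ c : ℝ, WeakL1 D
      (fun k p => 2 * c * (inner ℝ ξ (z k p).m - ρ * inner ℝ ξ (z k p).w))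
      fun p => 2 * c * (inner ℝ ξ (zbar p).m - ρ * inner ℝ ξ (zbar p).w) := fun ρ c =>
    ((hz.m.inner hD ξ).sub hD ((hz.w.inner hD ξ).const_mul ρ)).const_mul _
  have hplus := ((hpart ρm a).sub hD ((hz.μ.sub hD (.const ρm)).const_mul (a ^ 2))).const_mul ρp
  have hminus := ((hpart ρp b).sub hD
    ((WeakL1.sub hD (.const ρp) hz.μ).const_mul (b ^ 2))).const_mul ρm
  have hstress := WeakL1.sum hD Finset.univ fun i => WeakL1.sum hD Finset.univ fun j =>
    (hz.σ i j).const_mul (ξ i * ξ j)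
  have hrest := (hstress.add hD ((hz.e.const_mul (2 / (n : ℝ) * ‖ξ‖ ^ 2)))).const_mul (ρp - ρm)
  have := (hplus.add hD hminus).sub hD hrest
  simpa only [RayleighTaylor.supportFun, quadForm, mul_right_comm _ (‖ξ‖ ^ 2)] using this

variable {μ : ℕ → E n × ℝ → ℝ} {w : ℕ → E n × ℝ → E n} {q : ℕ → E n × ℝ → ℝ}
  {zbar : E n × ℝ → State n} {ρm ρp : ℝ}

theorem ae_mem_closure_hullInterior (hn : 0 < n) (hD : MeasurableSet D) (hρm : 0 < ρm)
    (hρ : ρm < ρp) (hμ : ∀ k, ∀ᵐ p ∂(volume.restrict D), μ k p = ρm ∨ μ k p = ρp)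
    (hz : StateWeakL1 D (fun k p => assocState (μ k p) (w k p) (q k p)) zbar) :
    ∀ᵐ p ∂(volume.restrict D), zbar p ∈ closure (hullInterior n ρm ρp) := by
  have h1 := (hz.μ.sub hD (.const ρm)).ae_nonneg fun k => by
    filter_upwards [hμ k] with p hp
    rcases hp with hp | hp <;> simp only [assocState, hp] <;> linarith
  have h2 := (WeakL1.sub hD (.const ρp) hz.μ).ae_nonneg fun k => by
    filter_upwards [hμ k] with p hp
    rcases hp with hp | hp <;> simp only [assocState, hp] <;> linarith
  -- Each parameter has its own null set, so only countably many are used here; continuity in `(ξ,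
  -- a, b)` recovers the others.
  have h3 : ∀ᵐ p ∂(volume.restrict D), ∀ N : ℕ,
      0 ≤ -1 * supportFun ρm ρp (TopologicalSpace.denseSeq (E n × ℝ × ℝ) N).1
        (TopologicalSpace.denseSeq (E n × ℝ × ℝ) N).2.1
        (TopologicalSpace.denseSeq (E n × ℝ × ℝ) N).2.2 (zbar p) := by
    refine ae_all_iff.2 fun N => ((hz.supportFun hD ρm ρp _ _ _).const_mul (-1)).ae_nonneg
      fun k => ?_
    filter_upwards [hμ k] with p hp
    have := supportFun_assocState_nonpos hρm hρ hp (w k p) (q k p)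
      (TopologicalSpace.denseSeq (E n × ℝ × ℝ) N).1
      (TopologicalSpace.denseSeq (E n × ℝ × ℝ) N).2.1
      (TopologicalSpace.denseSeq (E n × ℝ × ℝ) N).2.2
    linarith
  filter_upwards [h1, h2, h3] with p hp1 hp2 hp3
  refine mem_closure_hullInterior hn hρm hρ (sub_nonneg.1 hp1) (sub_nonneg.1 hp2) fun ξ a b => ?_
  exact (TopologicalSpace.denseRange_denseSeq (E n × ℝ × ℝ)).induction_on
    (p := fun x => supportFun ρm ρp x.1 x.2.1 x.2.2 (zbar p) ≤ 0) (ξ, a, b)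
    (isClosed_le (continuous_supportFun ρm ρp _) continuous_const) fun N => by linarith [hp3 N]

/-- Bounds of the form `‖f_k‖ ≤ g_k` pass to weak limits. -/
theorem WeakL1.ae_norm_le (hD : MeasurableSet D) {f : ℕ → E n × ℝ → E n}
    {flim : E n × ℝ → E n} {g : ℕ → E n × ℝ → ℝ} {glim : E n × ℝ → ℝ} (hf : WeakL1 D f flim)
    (hg : WeakL1 D g glim) (h : ∀ k, ∀ᵐ p ∂(volume.restrict D), ‖f k p‖ ≤ g k p) :
    ∀ᵐ p ∂(volume.restrict D), ‖flim p‖ ≤ glim p := by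
  have h1 : ∀ᵐ p ∂(volume.restrict D), ∀ N : ℕ,
      0 ≤ ‖TopologicalSpace.denseSeq (E n) N‖ * glim p
        - Inner.inner ℝ (TopologicalSpace.denseSeq (E n) N) (flim p) := by
    refine ae_all_iff.2 fun N => ((hg.const_mul _).sub hD (hf.inner hD _)).ae_nonneg fun k => ?_
    filter_upwards [h k] with p hp
    exact sub_nonneg.2 ((real_inner_le_norm _ _).trans
      (mul_le_mul_of_nonneg_left hp (norm_nonneg _)))
  -- Needed where the limit of `f` vanishes: there the choice `ξ = flim p` below gives no
  -- information on `glim p`.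
  have h2 := hg.ae_nonneg fun k => (h k).mono fun p hp => (norm_nonneg _).trans hp
  filter_upwards [h1, h2] with p hp hp0
  have key : ∀ ξ : E n, Inner.inner ℝ ξ (flim p) ≤ ‖ξ‖ * glim p := fun ξ =>
    (TopologicalSpace.denseRange_denseSeq (E n)).induction_on
      (p := fun ξ => Inner.inner ℝ ξ (flim p) ≤ ‖ξ‖ * glim p) ξ
      (isClosed_le (by fun_prop) (by fun_prop)) fun N => sub_nonneg.1 (hp N)
  by_cases h0 : ‖flim p‖ = 0
  · rwa [h0]
  · have h3 := key (flim p)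
    rw [real_inner_self_eq_norm_mul_norm] at h3
    exact le_of_mul_le_mul_left h3 (lt_of_le_of_ne (norm_nonneg _) (Ne.symm h0))

end Constraints

/-! ### Uniform bounds -/

section Bounds

variable {n : ℕ}

/-- Where `s` vanishes, division by zero returns `0`, which is the convention `T_± := 0`; the bound
is trivial there. The separate constants `c ≤ C` let `T₋`, with prefactor `ρ₋/2`, share the bound
with `ρ₊/2`. -/
theorem memLp_top_norm_sq_div_sq {α : Type*} [MeasurableSpace α] {ν : Measure α} {v : α → E n}
    {s : α → ℝ} (hv : AEStronglyMeasurable v ν) (hs : AEStronglyMeasurable s ν) {S : ℝ≥0∞}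
    (hS : S ≠ ⊤) (hvs : ∀ᵐ p ∂ν, ‖v p‖ ≤ S.toReal * |s p|) {c C : ℝ} (hc : 0 ≤ c) (hcC : c ≤ C) :
    MemLp (fun p => c / 2 * (‖v p‖ ^ 2 / s p ^ 2)) ⊤ ν ∧
      eLpNorm (fun p => c / 2 * (‖v p‖ ^ 2 / s p ^ 2)) ⊤ ν ≤ ENNReal.ofReal (C / 2) * S ^ 2 := by
  have hle : eLpNorm (fun p => c / 2 * (‖v p‖ ^ 2 / s p ^ 2)) ⊤ ν
      ≤ ENNReal.ofReal (C / 2) * S ^ 2 := by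
    rw [eLpNorm_exponent_top]
    refine eLpNormEssSup_le_of_ae_enorm_bound ?_
    filter_upwards [hvs] with p hp
    have hquot : ‖v p‖ ^ 2 / s p ^ 2 ≤ S.toReal ^ 2 := by
      refine div_le_of_le_mul₀ (sq_nonneg _) (sq_nonneg _) ?_
      rw [← sq_abs (s p), ← mul_pow]
      exact pow_le_pow_left₀ (norm_nonneg _) hp 2
    have hnn : 0 ≤ ‖v p‖ ^ 2 / s p ^ 2 := by positivity
    rw [Real.enorm_of_nonneg (by positivity), ← ENNReal.ofReal_toReal hS,
      ← ENNReal.ofReal_pow ENNReal.toReal_nonneg, ← ENNReal.ofReal_mul (by linarith)]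
    exact ENNReal.ofReal_le_ofReal (mul_le_mul (by linarith) hquot hnn (by linarith))
  refine ⟨⟨AEMeasurable.aestronglyMeasurable ?_, hle.trans_lt ?_⟩, hle⟩
  · exact ((hv.norm.aemeasurable.pow_const 2).div (hs.aemeasurable.pow_const 2)).const_mul _
  · exact ENNReal.mul_lt_top ENNReal.ofReal_lt_top (ENNReal.pow_lt_top hS.lt_top)

theorem ae_norm_le_toReal_iSup_eLpNorm {α F : Type*} [MeasurableSpace α] [NormedAddCommGroup F]
    {ν : Measure α} {w : ℕ → α → F} (h : ⨆ k, eLpNorm (w k) ⊤ ν ≠ ⊤) (k : ℕ) :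
    ∀ᵐ p ∂ν, ‖w k p‖ ≤ (⨆ k, eLpNorm (w k) ⊤ ν).toReal := by
  filter_upwards [ae_le_eLpNormEssSup (f := w k) (μ := ν)] with p hp
  rw [← eLpNorm_exponent_top] at hp
  rw [← toReal_enorm]
  exact ENNReal.toReal_mono h (hp.trans (le_iSup (fun k => eLpNorm (w k) ⊤ ν) k))

variable {D : Set (E n × ℝ)} {μ : ℕ → E n × ℝ → ℝ} {w : ℕ → E n × ℝ → E n}
  {q : ℕ → E n × ℝ → ℝ} {zbar : E n × ℝ → State n} {ρm ρp S : ℝ}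

/-- Along the sequence `m - ρ₋ w = (μ - ρ₋) w` with `μ - ρ₋ ≥ 0`, so the right-hand side is linear
in the state without an absolute value and the inequality passes to the limit. -/
theorem ae_norm_sub_lower_le (hD : MeasurableSet D) (hρ : ρm < ρp)
    (hμ : ∀ k, ∀ᵐ p ∂(volume.restrict D), μ k p = ρm ∨ μ k p = ρp)
    (hz : StateWeakL1 D (fun k p => assocState (μ k p) (w k p) (q k p)) zbar)
    (hw : ∀ k, ∀ᵐ p ∂(volume.restrict D), ‖w k p‖ ≤ S) :
    ∀ᵐ p ∂(volume.restrict D), ‖(zbar p).m - ρm • (zbar p).w‖ ≤ S * ((zbar p).μ - ρm) := by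
  refine (hz.m.sub hD (hz.w.const_smul ρm)).ae_norm_le hD
    ((hz.μ.sub hD (.const ρm)).const_mul S) fun k => ?_
  filter_upwards [hμ k, hw k] with p hp hwp
  have h0 : 0 ≤ μ k p - ρm := by rcases hp with hp | hp <;> rw [hp] <;> linarith
  simp only [assocState]
  rw [← sub_smul, norm_smul, Real.norm_of_nonneg h0, mul_comm]
  exact mul_le_mul_of_nonneg_right hwp h0

theorem ae_norm_sub_upper_le (hD : MeasurableSet D) (hρ : ρm < ρp)
    (hμ : ∀ k, ∀ᵐ p ∂(volume.restrict D), μ k p = ρm ∨ μ k p = ρp)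
    (hz : StateWeakL1 D (fun k p => assocState (μ k p) (w k p) (q k p)) zbar)
    (hw : ∀ k, ∀ᵐ p ∂(volume.restrict D), ‖w k p‖ ≤ S) :
    ∀ᵐ p ∂(volume.restrict D), ‖(zbar p).m - ρp • (zbar p).w‖ ≤ S * (ρp - (zbar p).μ) := by
  refine (hz.m.sub hD (hz.w.const_smul ρp)).ae_norm_le hD
    ((WeakL1.sub hD (.const ρp) hz.μ).const_mul S) fun k => ?_
  filter_upwards [hμ k, hw k] with p hp hwp
  have h0 : 0 ≤ ρp - μ k p := by rcases hp with hp | hp <;> rw [hp] <;> linarith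
  simp only [assocState]
  rw [← sub_smul, norm_smul, norm_sub_rev, Real.norm_of_nonneg h0, mul_comm]
  exact mul_le_mul_of_nonneg_right hwp h0

end Bounds

end RayleighTaylor

theorem proposition1p4 {n : ℕ} (hn : 2 ≤ n) (Ω : Set (E n)) (hΩ : IsOpen Ω)
    (g T ρm ρp : ℝ) (hg : 0 < g) (hT : 0 < T) (hρm : 0 < ρm) (hρ : ρm < ρp)
    (μ : ℕ → E n × ℝ → ℝ) (w : ℕ → E n × ℝ → E n) (q : ℕ → E n × ℝ → ℝ)
    (ν : ℕ → RadonOn (accDomain Ω g T))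
    (hsol : ∀ k, IsEulerSolution (accDomain Ω g T) (μ k) (w k) (q k) (ν k))
    (hμ : ∀ k, ∀ᵐ p ∂(volume.restrict (accDomain Ω g T)), μ k p = ρm ∨ μ k p = ρp)
    (zbar : E n × ℝ → State n) (qbar : E n × ℝ → ℝ) (νbar : RadonOn (accDomain Ω g T))
    (hz : StateWeakL1 (accDomain Ω g T) (fun k p => assocState (μ k p) (w k p) (q k p)) zbar)
    (hq : WeakL1 (accDomain Ω g T) q qbar)
    (hν : RadonOn.WeakTendsto (accDomain Ω g T) ν νbar) :
    -- the limit solves the linear system on the accelerated domain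
    IsLinearSolution (accDomain Ω g T) zbar qbar νbar ∧
    -- the limit takes values in the closure of the relaxed set
    (∀ᵐ p ∂(volume.restrict (accDomain Ω g T)), zbar p ∈ closure (hullInterior n ρm ρp)) ∧
    -- bounds in the case of uniformly bounded velocities
    ((⨆ k, eLpNorm (w k) ⊤ (volume.restrict (accDomain Ω g T))) < ⊤ →
      (MemLp (fun p => Tplus ρm ρp (zbar p)) ⊤ (volume.restrict (accDomain Ω g T)) ∧
        eLpNorm (fun p => Tplus ρm ρp (zbar p)) ⊤ (volume.restrict (accDomain Ω g T)) ≤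
          ENNReal.ofReal (ρp / 2) *
            (⨆ k, eLpNorm (w k) ⊤ (volume.restrict (accDomain Ω g T))) ^ 2) ∧
      (MemLp (fun p => Tminus ρm ρp (zbar p)) ⊤ (volume.restrict (accDomain Ω g T)) ∧
        eLpNorm (fun p => Tminus ρm ρp (zbar p)) ⊤ (volume.restrict (accDomain Ω g T)) ≤
          ENNReal.ofReal (ρp / 2) *
            (⨆ k, eLpNorm (w k) ⊤ (volume.restrict (accDomain Ω g T))) ^ 2)) ∧
    -- boundary condition and initial data are inherited by the limit
    (∀ (ρ₀ : E n → ℝ) (v₀ : E n → E n) (ν₀ : ℕ → RadonOn (accDomainInit Ω g T))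
      (ν₀bar : RadonOn (accDomainInit Ω g T)),
      (∀ k, IsEulerSolutionWithData Ω g T ρm ρp ρ₀ v₀ (μ k) (w k) (q k) (ν₀ k)) →
      RadonOn.WeakTendsto (accDomain Ω g T) ν₀ ν₀bar →
      IsLinearSolutionWithData Ω g T ρm ρp ρ₀ v₀ zbar qbar ν₀bar) := by
  have hopen := isOpen_accDomain hΩ g T
  have hmeas := hopen.measurableSet
  refine ⟨isLinearSolution_of_weakL1 hopen hsol hz hq hν,
    ae_mem_closure_hullInterior (by omega) hmeas hρm hρ hμ hz, fun hsup => ?_,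
    fun ρ₀ v₀ ν₀ ν₀bar hsol₀ hν₀ => isLinearSolutionWithData_of_weakL1 hΩ hsol₀ hz hq hν₀⟩
  have hw := ae_norm_le_toReal_iSup_eLpNorm hsup.ne
  have hm := hz.m.integrable_lim.aestronglyMeasurable
  have hv := hz.w.integrable_lim.aestronglyMeasurable
  have hd := hz.μ.integrable_lim.aestronglyMeasurable
  constructor
  · refine memLp_top_norm_sq_div_sq (hm.sub (hv.const_smul ρm))
      (hd.sub aestronglyMeasurable_const) hsup.ne ?_ (hρm.trans hρ).le le_rfl
    filter_upwards [ae_norm_sub_lower_le hmeas hρ hμ hz hw] with p hp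
    exact hp.trans (mul_le_mul_of_nonneg_left (le_abs_self _) ENNReal.toReal_nonneg)
  · refine memLp_top_norm_sq_div_sq (hm.sub (hv.const_smul ρp))
      (hd.sub aestronglyMeasurable_const) hsup.ne ?_ hρm.le hρ.le
    filter_upwards [ae_norm_sub_upper_le hmeas hρ hμ hz hw] with p hp
    refine hp.trans (mul_le_mul_of_nonneg_left ?_ ENNReal.toReal_nonneg)
    -- `Tminus` is written with `μ - ρ₊`, the negative of the quantity in the bound.
    exact (le_abs_self _).trans_eq (abs_sub_comm _ _)
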